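/- Let $G$ be a compact topological group (for example a finite group, or a connected compact group) acting continuously on a nonempty metric space $M$ with distance $\rho$, and suppose that $M$ is two-point-homogeneous: for all $x,y,x',y'\in M$ one has $\rho(x,y)=\rho(x',y')$ if and only if there is $g\in G$ with $gx=x'$ and $gy=y'$. Let $\mu$ be the $G$-invariant Borel probability measure on $M$. Let $\tau(x,y)$ be a real-valued injective function of the distance $\rho(x,y)$ (for example $\rho$ itself, or the inner product on a sphere), and let $\tau_0=\tau(x,x)$. Let $L^2(M,\mu)$ be the orthogonal direct sum (closure of the algebraic sum) of nonzero finite-dimensional irreducible $G$-invariant subspaces $V_0,V_1,V_2,\dots$ (a finite or infinite sequence), consisting of continuous functions. Put $h_k=\dim V_k$ (and $h_k=0$ if there is no $V_k$), let $(\phi_{k,i})_{i=1}^{h_k}$ be an orthonormal basis of $V_k$, and suppose that for each $k$ for which $V_k$ exists there is a real polynomial $\Phi_k$ of degree exactly $k$ with $$\frac1{h_k}\sum_{i=1}^{h_k}\phi_{k,i}(x)\overline{\phi_{k,i}(y)}=\Phi_k(\tau(x,y))\qquad(x,y\in M).$$ For a finite set $X\subset M$ let $D(X)=\{\tau(x,y):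 x,y\in X,\ x\ne y\}$. Let $s\ge 0$ be an integer; $X$ is an $s$-distance set if $|D(X)|=s$. Let $A(M,s)$ be the maximum cardinality of an $s$-distance set in $M$ (with the value $0$ if there is none), and let $N(M,s)=h_0+\cdots+h_{s-1}$. Let $\mathfrak D(M,s)$ be the family of all sets $D=\{d_1,\dots,d_s\}$ of $s$ elements such that $D=D(X)$ for some finite $X\subset M$ and such that $$K_i=\prod_{j\neq i}\frac{d_j-\tau_0}{d_j-d_i}$$ is an integer for every $i\in\{1,\dots,s\}$. For $D=\{d_1,\dots,d_s\}\in\mathfrak D(M,s)$ put $B(D)=\min\{H(D),L(D)\}$, where: * $H(D)=\sum_{i:\,f_i>0}h_i$, with $f_i$ the coefficients of the expansion $\prod_{j=1}^s\frac{d_j-t}{d_j-\tau_0}=\sum_{i=0}^s f_i\Phi_i(t)$ (harmonic absolute bound); * $L(D)=\sup\bigl\{1+\alpha_1+\cdots+\alpha_s:\ \alpha_i\ge0\ (1\le i\le s),\ \sum_{i=1}^s\alpha_i\Phi_k(d_i)\ge-1\text{ for all }k\text{ for which }V_k\text{ exists}\bigr\}$ (Delsarte's linear programming bound). Then the cardinalities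 of $s$-distance sets in $M$ are bounded, and $$A(M,s)\le\max\Bigl\{\,2N(M,s)-1,\ \sup_{D\in\mathfrak D(M,s)}B(D)\Bigr\}.$$ Moreover, $A(M,s)\le 2N(M,s)-1$, or $A(M,s)\le B(D)$ for some $D\in\mathfrak D(M,s)$. -/

import Mathlib

open MeasureTheory
open scoped ComplexConjugate

noncomputable section

namespace FewDistance

/-- The distance function of `M` is strongly invariant under `G`: two pairs of points are
equidistant exactly when some element of `G` carries one (ordered) pair to the other. -/
structure IsTwoPointHomogeneous (G M : Type*) [Group G] [MulAction G M] [MetricSpace M] :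
    Prop where
  strongly_invariant : ∀ x y x' y' : M,
    dist x y = dist x' y' ↔ ∃ g : G, g • x = x' ∧ g • y = y'

/-- The translate `x ↦ u (g • x)` of a continuous function. -/
def translate {G M : Type*} [Group G] [MulAction G M] [TopologicalSpace G] [MetricSpace M]
    [ContinuousSMul G M] (g : G) (u : C(M, ℂ)) : C(M, ℂ) :=
  u.comp ⟨fun x => g • x, continuous_const_smul g⟩

/-- A family of harmonic spaces on `M`: a decomposition of `L²(M, μ)` as the orthogonal direct sum
of nonzero finite-dimensional irreducible `G`-invariant subspaces `V 0, V 1, …`, with a chosen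
orthonormal basis of each. (Elements of such subspaces are continuous functions, so the `V k` are
recorded as subspaces of `C(M, ℂ)`.) If `L²(M, μ)` is finite-dimensional there are only finitely
many harmonic spaces, and then `V k = ⊥` for all larger `k`. -/
structure SphericalHarmonics (G : Type*) {M : Type*} [Group G] [TopologicalSpace G]
    [MetricSpace M] [MulAction G M] [ContinuousSMul G M] [MeasurableSpace M]
    (μ : Measure M) where
  /-- the `k`-th harmonic space -/
  V : ℕ → Submodule ℂ C(M, ℂ)
  finiteDimensional : ∀ k, FiniteDimensional ℂ (V k)
  /-- the harmonic spaces are numbered consecutively -/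
  consecutive : ∀ k, V k = ⊥ → V (k + 1) = ⊥
  invariant : ∀ (k : ℕ) (g : G), ∀ u ∈ V k, translate g u ∈ V k
  irreducible : ∀ (k : ℕ) (W : Submodule ℂ C(M, ℂ)), W ≤ V k →
    (∀ (g : G), ∀ u ∈ W, translate g u ∈ W) → W = ⊥ ∨ W = V k
  orthogonal : ∀ k l, k ≠ l → ∀ u ∈ V k, ∀ v ∈ V l, ∫ x, u x * conj (v x) ∂μ = 0
  /-- the algebraic sum of the harmonic spaces is dense in `L²(M, μ)` -/
  dense : ∀ u : M → ℂ, MemLp u 2 μ → ∀ ε : ENNReal, ε ≠ 0 →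
    ∃ v ∈ ⨆ k, V k, eLpNorm (fun x => u x - v x) 2 μ ≤ ε
  /-- an orthonormal basis of the `k`-th harmonic space -/
  φ : ∀ k, Fin (Module.finrank ℂ (V k)) → C(M, ℂ)
  orthonormal : ∀ k i j, ∫ x, φ k i x * conj (φ k j x) ∂μ = if i = j then 1 else 0
  span_φ : ∀ k, Submodule.span ℂ (Set.range (φ k)) = V k

namespace SphericalHarmonics

variable {G M : Type*} [Group G] [TopologicalSpace G] [MetricSpace M] [MulAction G M]
  [ContinuousSMul G M] [MeasurableSpace M] {μ : Measure M}

/-- `h_k = dim V_k`. -/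
def h (𝓗 : SphericalHarmonics G μ) (k : ℕ) : ℕ := Module.finrank ℂ (𝓗.V k)

/-- The zonal spherical kernel
`Φ_k(x, y) = (1 / h_k) * ∑ i, φ_{k,i}(x) * conj φ_{k,i}(y)`. -/
def zonal (𝓗 : SphericalHarmonics G μ) (k : ℕ) (x y : M) : ℂ :=
  (1 / (𝓗.h k : ℂ)) * ∑ i, 𝓗.φ k i x * conj (𝓗.φ k i y)

/-- `N(M, s) = h_0 + ⋯ + h_{s-1}`. -/
def N (𝓗 : SphericalHarmonics G μ) (s : ℕ) : ℕ := ∑ k ∈ Finset.range s, 𝓗.h k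

/-- `Φ` expresses the zonal spherical functions as polynomials in the variable `τ(dist x y)`;
the degree of `Φ k` is `k` by the definition of `Polynomial.Sequence`. Only the indices of nonzero
harmonic spaces matter. -/
def IsZonalFamily (𝓗 : SphericalHarmonics G μ) (τ : ℝ → ℝ) (Φ : Polynomial.Sequence ℝ) : Prop :=
  ∀ k, 𝓗.V k ≠ ⊥ → ∀ x y : M, 𝓗.zonal k x y = (((Φ k).eval (τ (dist x y)) : ℝ) : ℂ)

end SphericalHarmonics

section Codes

variable {M : Type*} [MetricSpace M]

open Classical in
/-- `D(X)`, the set of values of `τ` at pairs of distinct points of `X`. -/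
def distances (τ : ℝ → ℝ) (X : Finset M) : Finset ℝ :=
  X.offDiag.image fun p => τ (dist p.1 p.2)

/-- `X` is an `s`-distance set. -/
def IsDistanceSet (τ : ℝ → ℝ) (s : ℕ) (X : Finset M) : Prop := (distances τ X).card = s

variable (M) in
/-- The set of cardinalities of `s`-distance sets in `M`. -/
def codeSizes (τ : ℝ → ℝ) (s : ℕ) : Set ℕ :=
  {n | ∃ X : Finset M, IsDistanceSet τ s X ∧ X.card = n}

variable (M) in
/-- `A(M, s)`, the maximum cardinality of an `s`-distance set in `M`. -/
def maxCode (τ : ℝ → ℝ) (s : ℕ) : ℕ := sSup (codeSizes M τ s)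

/-- The ratio `K_d = ∏_{e ∈ D, e ≠ d} (e - τ₀) / (e - d)`. -/
def ratio (τ₀ : ℝ) (D : Finset ℝ) (d : ℝ) : ℝ := ∏ e ∈ D.erase d, (e - τ₀) / (e - d)

variable (M) in
/-- The admissible distance sets `𝔇(M, s)`: the `s`-element sets `D(X)`, with `X` a finite subset
of `M`, all of whose ratios `K_d` are integers. -/
def admissible (τ : ℝ → ℝ) (s : ℕ) : Set (Finset ℝ) :=
  {D | (∃ X : Finset M, IsDistanceSet τ s X ∧ distances τ X = D) ∧
    ∀ d ∈ D, ∃ z : ℤ, ratio (τ 0) D d = z}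

end Codes

/-- The polynomial `f(t) = ∏_{d ∈ D} (d - t) / (d - τ₀)`. -/
def annihilator (τ₀ : ℝ) (D : Finset ℝ) : Polynomial ℝ :=
  ∏ d ∈ D, Polynomial.C (d - τ₀)⁻¹ * (Polynomial.C d - Polynomial.X)

/-- The coefficients `f_i` in the expansion `f = ∑ i, f_i Φ_i`. -/
def expansion (Φ : Polynomial.Sequence ℝ) (f : Polynomial ℝ) : ℕ →₀ ℝ :=
  (Φ.basis fun i => (Polynomial.leadingCoeff_ne_zero.mpr (Φ.ne_zero i)).isUnit).repr f

section Bounds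

variable {G M : Type*} [Group G] [TopologicalSpace G] [MetricSpace M] [MulAction G M]
  [ContinuousSMul G M] [MeasurableSpace M] {μ : Measure M}

/-- The harmonic absolute bound `H(D) = ∑_{i : f_i > 0} h_i`. -/
def harmonicBound (𝓗 : SphericalHarmonics G μ) (τ : ℝ → ℝ) (Φ : Polynomial.Sequence ℝ)
    (D : Finset ℝ) : ℕ :=
  ∑ i ∈ (expansion Φ (annihilator (τ 0) D)).support with
    0 < expansion Φ (annihilator (τ 0) D) i, 𝓗.h i

/-- Delsarte's linear programming bound `L(D)`: the supremum of `1 + ∑_{d ∈ D} α_d` subject to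
`α_d ≥ 0` and `∑_{d ∈ D} α_d Φ_k(d) ≥ -1` for every `k` indexing a harmonic space. -/
def lpBound (𝓗 : SphericalHarmonics G μ) (Φ : Polynomial.Sequence ℝ) (D : Finset ℝ) : EReal :=
  sSup {v | ∃ α : ℝ → ℝ, (∀ d ∈ D, 0 ≤ α d) ∧
    (∀ k, 𝓗.V k ≠ ⊥ → -1 ≤ ∑ d ∈ D, α d * (Φ k).eval d) ∧
    v = ((1 + ∑ d ∈ D, α d : ℝ) : EReal)}

/-- `B(D) = min {H(D), L(D)}`. -/
def bound (𝓗 : SphericalHarmonics G μ) (τ : ℝ → ℝ) (Φ : Polynomial.Sequence ℝ)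
    (D : Finset ℝ) : EReal :=
  min (((harmonicBound 𝓗 τ Φ D : ℕ) : ℝ) : EReal) (lpBound 𝓗 Φ D)

end Bounds

end FewDistance

end

/-! Let X be an s-distance set with |X| ≥ 2N(M,s), let d ∈ D = D(X), and let A be the adjacency
matrix of the graph on X joining x and y when τ(x,y) = d. The polynomial f(t) = ∏_{e ∈ D, e ≠ d} (e
- t)/(e - d) is 1 at d, 0 at the other elements of D and K_d at τ₀, so the matrix (f(τ(x,y))) is K_d
I + A. As deg f = s - 1, f is a combination of Φ_0, …, Φ_{s-1} and this matrix has rank at most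
N(M,s). Hence -K_d is an eigenvalue of A of multiplicity at least |X|/2.

Such an eigenvalue is an integer (`Matrix.exists_int_eq_of_card_le_two_mul_finrank_eigenspace`): its
conjugates have the same multiplicity, so it has degree at most 2. In degree 2 the two conjugates
are the whole spectrum, which makes the graph regular, and its valency is then a rational
eigenvalue, a contradiction. So D is admissible (`exists_int_ratio_eq`).

Positive semidefiniteness of the zonal kernels gives |X| ≤ H(D) and |X| ≤ L(D)
(`card_le_harmonicBound`, `card_le_lpBound`). If V_s = 0, then M itself has at most N(M,s) points
(`card_le_card_of_dense_span`). -/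

/-! ### Eigenvalues of large multiplicity of graphs. -/

open Polynomial in
/-- If `x` is a root of `f` of multiplicity at least `m`, so are all its conjugates. -/
theorem minpoly_pow_dvd_of_le_rootMultiplicity {K L : Type*} [Field K] [Field L] [Algebra K L]
    [CharZero K] (x : L) (m : ℕ) (f : K[X]) (hf : f ≠ 0)
    (h : m ≤ (f.map (algebraMap K L)).rootMultiplicity x) : minpoly K x ^ m ∣ f := by
  induction m generalizing f with
  | zero => simp
  | succ m ih =>
    have hmap : f.map (algebraMap K L) ≠ 0 :=
      (Polynomial.map_ne_zero_iff (algebraMap K L).injective).2 hf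
    have hroot : aeval x f = 0 := by
      have := (rootMultiplicity_pos (x := x) hmap).1 (by omega)
      rwa [IsRoot, eval_map_algebraMap] at this
    have hx : IsIntegral K x := IsAlgebraic.isIntegral ⟨f, hf, hroot⟩
    obtain ⟨g, rfl⟩ := minpoly.dvd K x hroot
    have hg : g ≠ 0 := right_ne_zero_of_mul hf
    rw [Polynomial.map_mul] at h hmap
    rw [rootMultiplicity_mul hmap] at h
    -- In characteristic zero the minimal polynomial is separable, so removing one factor lowers the
    -- multiplicity of `x` by at most one.
    have hsep : ((minpoly K x).map (algebraMap K L)).Separable :=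
      (minpoly.irreducible hx).separable.map
    have h1 := rootMultiplicity_le_one_of_separable hsep x
    rw [pow_succ']
    exact mul_dvd_mul_left _ (ih g hg (by omega))

/-- A nilpotent symmetric rational matrix vanishes. -/
theorem Matrix.IsSymm.eq_zero_of_pow_eq_zero {ι : Type*} [Fintype ι] [DecidableEq ι]
    {B : Matrix ι ι ℚ} (hB : B.IsSymm) {m : ℕ} (h : B ^ m = 0) : B = 0 := by
  -- For symmetric C, C² = CᵀC, which vanishes only if C does; this halves exponents that are powers
  -- of two.
  have key : ∀ k : ℕ, B ^ 2 ^ k = 0 → B = 0 := by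
    intro k
    induction k with
    | zero => simp
    | succ k ih =>
      intro hk
      refine ih ?_
      have hs : (B ^ 2 ^ k).IsSymm := hB.pow _
      rw [← Matrix.conjTranspose_mul_self_eq_zero, Matrix.conjTranspose_eq_transpose_of_trivial,
        hs.eq, ← pow_two, ← pow_mul, ← pow_succ, hk]
  exact key m (pow_eq_zero_of_le Nat.lt_two_pow_self.le h)

open Polynomial in
/-- An eigenvalue of the adjacency matrix of a finite graph whose multiplicity is at least half of
the number of vertices is an integer. -/
theorem Matrix.exists_int_eq_of_card_le_two_mul_finrank_eigenspace {ι : Type*} [Fintype ι]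
    [DecidableEq ι] [Nonempty ι] (A : Matrix ι ι ℤ) (hA : A.IsSymm)
    (hdiag : ∀ i, A i i = 0)
    (h01 : ∀ i j, A i j = 0 ∨ A i j = 1) (θ : ℂ)
    (h : Fintype.card ι ≤ 2 * Module.finrank ℂ
      (Module.End.eigenspace (Matrix.toLin' (A.map (Int.cast : ℤ → ℂ))) θ)) :
    ∃ z : ℤ, θ = z := by
  set m := Module.finrank ℂ (Module.End.eigenspace (Matrix.toLin' (A.map (Int.cast : ℤ → ℂ))) θ)
    with hm
  set B : Matrix ι ι ℚ := A.map (Int.cast : ℤ → ℚ) with hBdef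
  have hBC : B.map (algebraMap ℚ ℂ) = A.map (Int.cast : ℤ → ℂ) := by
    ext i j; simp [hBdef]
  have hBsymm : B.IsSymm := by
    rw [Matrix.IsSymm, hBdef, ← Matrix.transpose_map, hA.eq]
  have hcard : 0 < Fintype.card ι := Fintype.card_pos
  have hmul : m ≤ (B.charpoly.map (algebraMap ℚ ℂ)).rootMultiplicity θ := by
    rw [← Matrix.charpoly_map, hBC, ← Matrix.charpoly_toLin', hm]
    exact LinearMap.finrank_eigenspace_le _ _
  have hne : B.charpoly ≠ 0 := B.charpoly_monic.ne_zero
  have hdvd := minpoly_pow_dvd_of_le_rootMultiplicity θ m B.charpoly hne hmul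
  have hroot : aeval θ A.charpoly = 0 := by
    have hmapne : B.charpoly.map (algebraMap ℚ ℂ) ≠ 0 := (B.charpoly_monic.map _).ne_zero
    have h1 := (rootMultiplicity_pos (x := θ) hmapne).1 (by omega)
    have h2 : B.charpoly.map (algebraMap ℚ ℂ) = A.charpoly.map (algebraMap ℤ ℂ) := by
      rw [← Matrix.charpoly_map, ← Matrix.charpoly_map, hBC]; rfl
    rwa [h2, IsRoot, eval_map_algebraMap] at h1
  have hint : IsIntegral ℤ θ := ⟨A.charpoly, A.charpoly_monic, by rwa [← aeval_def]⟩
  have hintQ : IsIntegral ℚ θ := hint.tower_top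
  have hpm := minpoly.monic hintQ
  have hdeg : (minpoly ℚ θ).natDegree * m ≤ Fintype.card ι := by
    have := natDegree_le_of_dvd hdvd hne
    rwa [hpm.natDegree_pow, Matrix.charpoly_natDegree_eq_dim, mul_comm] at this
  have hpos := minpoly.natDegree_pos hintQ
  have hle2 : (minpoly ℚ θ).natDegree ≤ 2 := by
    by_contra hlt
    have : 3 * m ≤ (minpoly ℚ θ).natDegree * m := Nat.mul_le_mul_right _ (by omega)
    omega
  obtain h1 | h2 : (minpoly ℚ θ).natDegree = 1 ∨ (minpoly ℚ θ).natDegree = 2 := by omega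
  · obtain ⟨q, hq⟩ := minpoly.natDegree_eq_one_iff.1 h1
    have : IsIntegral ℤ q := by
      rw [← hq] at hint
      exact (isIntegral_algebraMap_iff (algebraMap ℚ ℂ).injective).1 hint
    obtain ⟨z, hz⟩ := IsIntegrallyClosed.isIntegral_iff.1 this
    exact ⟨z, by rw [← hq, ← hz]; simp⟩
  -- Degree 2 forces the size to be 2m and the characteristic polynomial to be the m-th power of the
  -- minimal polynomial X² + bX + c of θ.
  · exfalso
    have hchar : minpoly ℚ θ ^ m = B.charpoly := by
      refine (eq_of_monic_of_dvd_of_natDegree_le (hpm.pow m) B.charpoly_monic hdvd ?_).symm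
      rw [hpm.natDegree_pow, Matrix.charpoly_natDegree_eq_dim, h2]
      omega
    obtain ⟨b, c, hp⟩ : ∃ b c : ℚ, minpoly ℚ θ = X ^ 2 + C b * X + C c := by
      refine ⟨(minpoly ℚ θ).coeff 1, (minpoly ℚ θ).coeff 0, ?_⟩
      conv_lhs => rw [hpm.as_sum, h2]
      simp [Finset.sum_range_succ]
      ring
    have hpow : (B ^ 2 + b • B + c • (1 : Matrix ι ι ℚ)) ^ m = 0 := by
      have := Matrix.aeval_self_charpoly B
      rw [← hchar, hp] at this
      simpa [Algebra.smul_def] using this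
    have hquad : B ^ 2 + b • B + c • (1 : Matrix ι ι ℚ) = 0 := by
      refine Matrix.IsSymm.eq_zero_of_pow_eq_zero ?_ hpow
      exact ((hBsymm.pow 2).add (hBsymm.smul b)).add (Matrix.isSymm_one.smul c)
    have hsq : ∀ i j, B i j * B j i = B i j := by
      intro i j
      have : B j i = B i j := hBsymm.apply i j
      rw [this]
      rcases h01 i j with h | h <;> simp [hBdef, h]
    -- The diagonal of B² + bB + c = 0 shows that every vertex has valency -c, so the all-ones
    -- vector is an eigenvector.
    have hdeg : ∀ i, ∑ j, B i j = -c := by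
      intro i
      have := congrFun (congrFun hquad i) i
      have hd : B i i = 0 := by simp [hBdef, hdiag i]
      simp [pow_two, Matrix.mul_apply, hsq, hd] at this
      linarith
    have hone : B.mulVec 1 = (-c) • (1 : ι → ℚ) := by
      ext i; simp [Matrix.mulVec, dotProduct, hdeg]
    have hzero : (c ^ 2 + b * (-c) + c) = 0 := by
      obtain ⟨i⟩ := ‹Nonempty ι›
      have := congrFun (congrArg (fun P : Matrix ι ι ℚ => P.mulVec 1) hquad) i
      simp [Matrix.add_mulVec, pow_two, ← Matrix.mulVec_mulVec, hone, Matrix.smul_mulVec,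
        Matrix.mulVec_smul, Matrix.mulVec_neg] at this
      linarith
    have hrt : (minpoly ℚ θ).IsRoot (-c) := by
      rw [hp]; simp; linarith
    have h1 : (minpoly ℚ θ).natDegree = 1 := natDegree_eq_of_degree_eq_some
      (degree_eq_one_of_irreducible_of_root (minpoly.irreducible hintQ) hrt)
    omega

/-! ### Dense spans and the number of points. -/

/-- If a finite set of continuous functions spans a dense subspace of `L²`, and nonempty open sets
have positive measure, then the space has at most as many points as there are functions. -/
theorem card_le_card_of_dense_span {M ι : Type*} [MetricSpace M] [CompactSpace M]
    [MeasurableSpace M] [BorelSpace M] (μ : Measure M) [IsFiniteMeasure μ]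
    [μ.IsOpenPosMeasure] [Fintype ι] (φ : ι → C(M, ℂ)) (W : Submodule ℂ C(M, ℂ))
    (hW : W ≤ Submodule.span ℂ (Set.range φ))
    (dense : ∀ u : M → ℂ, MemLp u 2 μ → ∀ ε : ENNReal, ε ≠ 0 →
      ∃ v ∈ W, eLpNorm (fun x => u x - v x) 2 μ ≤ ε) (X : Finset M) :
    X.card ≤ Fintype.card ι := by
  classical
  by_contra hlt
  push Not at hlt
  obtain ⟨r, hr, hdisj⟩ : ∃ r > 0, ∀ x ∈ X, ∀ y ∈ X, x ≠ y →
      Disjoint (Metric.ball x r) (Metric.ball y r) := by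
    obtain ⟨U, hU, hUd⟩ := (X : Set M).toFinite.t2_separation
    have : ∀ x : M, ∃ r > 0, Metric.ball x r ⊆ U x := fun x =>
      Metric.isOpen_iff.1 (hU x).2 x (hU x).1
    choose ρ hρ hρU using this
    have hXne : X.Nonempty := Finset.card_pos.1 (by omega)
    refine ⟨X.inf' hXne ρ, (Finset.lt_inf'_iff _).2 fun x _ => hρ x, fun x hx y hy hxy => ?_⟩
    exact (hUd hx hy hxy).mono
      ((Metric.ball_subset_ball (Finset.inf'_le _ hx)).trans (hρU x))
      ((Metric.ball_subset_ball (Finset.inf'_le _ hy)).trans (hρU y))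
  let e : X → Lp ℂ 2 μ := fun x =>
    indicatorConstLp 2 (measurableSet_ball (x := (x : M)) (ε := r)) (measure_ne_top _ _) 1
  have he : LinearIndependent ℂ e := by
    refine linearIndependent_of_ne_zero_of_inner_eq_zero (fun x => ?_) fun x y hxy => ?_
    · rw [← norm_ne_zero_iff, norm_indicatorConstLp (by simp) (by simp)]
      have : 0 < μ.real (Metric.ball (x : M) r) :=
        ENNReal.toReal_pos (Metric.measure_ball_pos μ _ hr).ne' (measure_ne_top _ _)
      rw [norm_one, one_mul]
      exact (Real.rpow_pos_of_pos this _).ne'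
    · simp only [e]
      rw [L2.inner_indicatorConstLp_indicatorConstLp,
        (hdisj x x.2 y y.2 fun h => hxy (Subtype.ext h)).inter_eq]
      simp
  -- With more balls than functions, some nonzero combination of the indicators is orthogonal to
  -- every φ_i, hence to `W`.
  let T : (X → ℂ) →ₗ[ℂ] (ι → ℂ) := LinearMap.pi fun i =>
    (innerSL ℂ (ContinuousMap.toLp 2 μ ℂ (φ i))).toLinearMap ∘ₗ Fintype.linearCombination ℂ e
  obtain ⟨c, hc, hc0⟩ := Submodule.exists_mem_ne_zero_of_ne_bot
    (LinearMap.ker_ne_bot_of_finrank_lt (f := T) (by simpa using hlt))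
  set u : Lp ℂ 2 μ := Fintype.linearCombination ℂ e c with hu
  have hu0 : u ≠ 0 := by
    intro h
    exact hc0 (he.fintypeLinearCombination_injective (by rw [← hu, h, map_zero]))
  have horth : ∀ v ∈ W, inner ℂ u (ContinuousMap.toLp 2 μ ℂ v) = 0 := by
    have hle : W ≤ LinearMap.ker
        ((innerSL ℂ u).toLinearMap ∘ₗ (ContinuousMap.toLp 2 μ ℂ).toLinearMap) := by
      refine hW.trans (Submodule.span_le.2 ?_)
      rintro _ ⟨i, rfl⟩
      have : inner ℂ (ContinuousMap.toLp 2 μ ℂ (φ i)) u = 0 :=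
        congrFun (LinearMap.mem_ker.1 hc) i
      exact inner_eq_zero_symm.1 this
    exact fun v hv => hle hv
  have hnorm : 0 < ‖u‖ := norm_pos_iff.2 hu0
  obtain ⟨v, hv, hle⟩ := dense u (Lp.memLp u) (ENNReal.ofReal (‖u‖ / 2)) (by simpa using hu0)
  have hdist : ‖u - ContinuousMap.toLp 2 μ ℂ v‖ ≤ ‖u‖ / 2 := by
    rw [Lp.norm_def]
    refine ENNReal.toReal_le_of_le_ofReal (by positivity) (le_trans (le_of_eq ?_) hle)
    refine eLpNorm_congr_ae ?_
    filter_upwards [Lp.coeFn_sub u (ContinuousMap.toLp 2 μ ℂ v),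
      ContinuousMap.coeFn_toLp (p := 2) (𝕜 := ℂ) μ v] with x h1 h2
    rw [h1, Pi.sub_apply, h2]
  -- By orthogonality ‖u - v‖² = ‖u‖² + ‖v‖², which is incompatible with ‖u - v‖ ≤ ‖u‖/2.
  have hge := norm_sub_sq (𝕜 := ℂ) u (ContinuousMap.toLp 2 μ ℂ v)
  rw [horth v hv, map_zero] at hge
  nlinarith [norm_nonneg (u - ContinuousMap.toLp 2 μ ℂ v), sq_nonneg ‖ContinuousMap.toLp 2 μ ℂ v‖]

/-! ### Compactness and positivity from homogeneity. -/

namespace FewDistance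

variable {G M : Type*} [Group G] [MetricSpace M] [MulAction G M]

namespace IsTwoPointHomogeneous

theorem isPretransitive (hM : IsTwoPointHomogeneous G M) : MulAction.IsPretransitive G M :=
  ⟨fun x y => by
    obtain ⟨g, hg, -⟩ := (hM.strongly_invariant x x y y).1 (by simp)
    exact ⟨g, hg⟩⟩

theorem compactSpace [TopologicalSpace G] [CompactSpace G] [ContinuousSMul G M] [Nonempty M]
    (hM : IsTwoPointHomogeneous G M) : CompactSpace M := by
  obtain ⟨x⟩ := ‹Nonempty M›
  have := hM.isPretransitive
  exact (MulAction.surjective_smul G x).compactSpace (continuous_id.smul continuous_const)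

/-- Translates of a nonempty open set cover the compact space M, so that set cannot be null. This
keeps indicators of balls nonzero in L². -/
theorem isOpenPosMeasure [TopologicalSpace G] [CompactSpace G] [ContinuousSMul G M] [Nonempty M] [MeasurableSpace M]
    (hM : IsTwoPointHomogeneous G M) (μ : Measure M) [IsProbabilityMeasure μ]
    [SMulInvariantMeasure G M μ] : μ.IsOpenPosMeasure := by
  have := hM.isPretransitive
  have := hM.compactSpace
  exact ⟨fun U hU hne => (measure_isOpen_pos_of_smulInvariant_of_compact_ne_zero G
    isCompact_univ (by simp) hU hne).ne'⟩

end IsTwoPointHomogeneous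

/-! ### Moments and positivity of the zonal kernels. -/

namespace SphericalHarmonics

variable [TopologicalSpace G] [ContinuousSMul G M] [MeasurableSpace M] {μ : Measure M}

theorem V_eq_bot_of_le (𝓗 : SphericalHarmonics G μ) {k l : ℕ} (h : 𝓗.V k = ⊥) (hkl : k ≤ l) :
    𝓗.V l = ⊥ := by
  induction hkl with
  | refl => exact h
  | step _ ih => exact 𝓗.consecutive _ ih

theorem h_pos (𝓗 : SphericalHarmonics G μ) {k : ℕ} (h : 𝓗.V k ≠ ⊥) : 0 < 𝓗.h k := by
  have := 𝓗.finiteDimensional k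
  have := Submodule.nontrivial_iff_ne_bot.2 h
  exact Module.finrank_pos (R := ℂ) (M := 𝓗.V k)

theorem card_sigma (𝓗 : SphericalHarmonics G μ) (S : Finset ℕ) :
    Fintype.card (Σ k : S, Fin (𝓗.h k)) = ∑ k ∈ S, 𝓗.h k := by
  simp [Finset.sum_attach S fun k => 𝓗.h k]

/-- If the harmonic spaces stop before `V s`, then `M` has at most `N(M, s)` points. -/
theorem card_le_N_of_V_eq_bot [CompactSpace M] [BorelSpace M] [IsFiniteMeasure μ]
    [μ.IsOpenPosMeasure] (𝓗 : SphericalHarmonics G μ) {s : ℕ} (h : 𝓗.V s = ⊥) (X : Finset M) :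
    X.card ≤ 𝓗.N s := by
  have := card_le_card_of_dense_span μ
    (fun p : Σ k : Finset.range s, Fin (𝓗.h k) => 𝓗.φ p.1 p.2) (⨆ k, 𝓗.V k) ?_ 𝓗.dense X
  · rwa [card_sigma] at this
  · refine iSup_le fun k => ?_
    by_cases hk : k < s
    · rw [← 𝓗.span_φ k]
      refine Submodule.span_mono ?_
      rintro _ ⟨i, rfl⟩
      exact ⟨⟨⟨k, Finset.mem_range.2 hk⟩, i⟩, rfl⟩
    · rw [𝓗.V_eq_bot_of_le h (not_lt.1 hk)]
      exact bot_le

/-- The linear functional `c ↦ ∑ y ∈ X, c_y conj φ_{k,i}(y)`. -/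
noncomputable def moment (𝓗 : SphericalHarmonics G μ) (X : Finset M) (k : ℕ)
    (i : Fin (Module.finrank ℂ (𝓗.V k))) :
    (X → ℂ) →ₗ[ℂ] ℂ :=
  ∑ y : X, (conj (𝓗.φ k i y)) • LinearMap.proj y

theorem moment_apply (𝓗 : SphericalHarmonics G μ) (X : Finset M) (k : ℕ)
    (i : Fin (Module.finrank ℂ (𝓗.V k)))
    (c : X → ℂ) : 𝓗.moment X k i c = ∑ y : X, conj (𝓗.φ k i y) * c y := by
  simp [moment]

/-- The moments of degrees in `S`, taken together. -/
noncomputable def moments (𝓗 : SphericalHarmonics G μ) (X : Finset M) (S : Finset ℕ) :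
    (X → ℂ) →ₗ[ℂ] ((Σ k : S, Fin (𝓗.h k)) → ℂ) :=
  LinearMap.pi fun p => 𝓗.moment X p.1 p.2

theorem moment_eq_zero (𝓗 : SphericalHarmonics G μ) {X : Finset M} {S : Finset ℕ} {c : X → ℂ}
    (hc : c ∈ LinearMap.ker (𝓗.moments X S)) {k : ℕ} (hk : k ∈ S)
    (i : Fin (Module.finrank ℂ (𝓗.V k))) :
    𝓗.moment X k i c = 0 :=
  congrFun (LinearMap.mem_ker.1 hc) ⟨⟨k, hk⟩, i⟩

/-- Rank–nullity. The kernel is shown to vanish for the harmonic bound, and to lie in an eigenspace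
for the integrality of the ratios. -/
theorem card_le_add_finrank_ker_moments (𝓗 : SphericalHarmonics G μ) (X : Finset M)
    (S : Finset ℕ) :
    X.card ≤ ∑ k ∈ S, 𝓗.h k + Module.finrank ℂ (LinearMap.ker (𝓗.moments X S)) := by
  have h1 := LinearMap.finrank_range_add_finrank_ker (𝓗.moments X S)
  have h2 := Submodule.finrank_le (LinearMap.range (𝓗.moments X S))
  rw [Module.finrank_fintype_fun_eq_card, card_sigma] at h2
  rw [Module.finrank_fintype_fun_eq_card, Fintype.card_coe] at h1
  omega

theorem sum_zonal_mul (𝓗 : SphericalHarmonics G μ) (X : Finset M) (k : ℕ) (c : X → ℂ) (x : M) :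
    ∑ y : X, 𝓗.zonal k x y * c y
      = (1 / (𝓗.h k : ℂ)) * ∑ i, 𝓗.φ k i x * 𝓗.moment X k i c := by
  simp only [zonal, moment_apply, Finset.mul_sum, Finset.sum_mul]
  rw [Finset.sum_comm]
  simp only [mul_assoc]

/-- The zonal kernel is a Gram kernel, so its quadratic form is a sum of squares of moments; both
bounds rest on this. -/
theorem sum_conj_mul_zonal_mul (𝓗 : SphericalHarmonics G μ) (X : Finset M) (k : ℕ) (c : X → ℂ) :
    ∑ x : X, conj (c x) * ∑ y : X, 𝓗.zonal k x y * c y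
      = (((1 / (𝓗.h k : ℝ)) * ∑ i, ‖𝓗.moment X k i c‖ ^ 2 : ℝ) : ℂ) := by
  have : ∀ i, ((‖𝓗.moment X k i c‖ ^ 2 : ℝ) : ℂ)
      = ∑ x : X, conj (c x) * 𝓗.φ k i x * 𝓗.moment X k i c := by
    intro i
    rw [← Finset.sum_mul, Complex.ofReal_pow, ← Complex.conj_mul']
    congr 1
    simp [moment_apply, mul_comm]
  simp only [sum_zonal_mul]
  push_cast [this]
  simp only [Finset.mul_sum]
  rw [Finset.sum_comm]
  refine Finset.sum_congr rfl fun i _ => Finset.sum_congr rfl fun x _ => ?_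
  ring

namespace IsZonalFamily

variable {𝓗 : SphericalHarmonics G μ} {τ : ℝ → ℝ} {Φ : Polynomial.Sequence ℝ}

/-- The zonal polynomials are normalized at the diagonal. -/
theorem eval_zero [CompactSpace M] [Nonempty M] [BorelSpace M] [IsProbabilityMeasure μ]
    (hΦ : 𝓗.IsZonalFamily τ Φ) {k : ℕ} (hk : 𝓗.V k ≠ ⊥) : (Φ k).eval (τ 0) = 1 := by
  have h0 : (𝓗.h k : ℂ) ≠ 0 := by exact_mod_cast (𝓗.h_pos hk).ne'
  -- The diagonal value is constant, so it equals its mean; each of the h_k basis functions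
  -- contributes 1/h_k.
  have h1 : ∫ x, 𝓗.zonal k x x ∂μ = 1 := by
    simp only [zonal]
    rw [integral_const_mul, integral_finsetSum]
    · simp [𝓗.orthonormal]
      exact inv_mul_cancel₀ h0
    · intro i _
      exact ((𝓗.φ k i).continuous.mul
        (Complex.continuous_conj.comp (𝓗.φ k i).continuous)).integrable_of_hasCompactSupport
        (HasCompactSupport.of_compactSpace _)
  have h2 : ∀ x, 𝓗.zonal k x x = ((Φ k).eval (τ 0) : ℝ) := fun x => by rw [hΦ k hk, dist_self]
  simp only [h2] at h1
  simpa using h1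

theorem sum_conj_mul_eval_mul (hΦ : 𝓗.IsZonalFamily τ Φ) {k : ℕ} (hk : 𝓗.V k ≠ ⊥)
    (X : Finset M) (c : X → ℂ) :
    ∑ x : X, conj (c x) * ∑ y : X, (((Φ k).eval (τ (dist (x : M) y)) : ℝ) : ℂ) * c y
      = (((1 / (𝓗.h k : ℝ)) * ∑ i, ‖𝓗.moment X k i c‖ ^ 2 : ℝ) : ℂ) := by
  simp only [← hΦ k hk, sum_conj_mul_zonal_mul]

theorem sum_eval_nonneg (hΦ : 𝓗.IsZonalFamily τ Φ) {k : ℕ} (hk : 𝓗.V k ≠ ⊥) (X : Finset M) :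
    0 ≤ ∑ x ∈ X, ∑ y ∈ X, (Φ k).eval (τ (dist x y)) := by
  have := hΦ.sum_conj_mul_eval_mul hk X 1
  simp only [Pi.one_apply, map_one, one_mul, mul_one] at this
  norm_cast at this
  rw [← Finset.sum_coe_sort]
  simp only [← Finset.sum_coe_sort X fun y => (Φ k).eval (τ (dist _ y))]
  rw [this]
  positivity

end IsZonalFamily
end SphericalHarmonics
end FewDistance

/-! ### Expansions in the zonal polynomials. -/

namespace Polynomial.Sequence

theorem sum_basis_repr_smul (Φ : Polynomial.Sequence ℝ) (f : Polynomial ℝ) :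
    ∑ i ∈ (FewDistance.expansion Φ f).support, FewDistance.expansion Φ f i • Φ i = f := by
  conv_rhs => rw [← (Φ.basis fun i =>
    (Polynomial.leadingCoeff_ne_zero.mpr (Φ.ne_zero i)).isUnit).linearCombination_repr f]
  simp [Finsupp.linearCombination_apply, Finsupp.sum, FewDistance.expansion]

/-- The expansion of a polynomial of degree less than `n` stops before the index `n`. -/
theorem expansion_support_subset (Φ : Polynomial.Sequence ℝ) {f : Polynomial ℝ} {n : ℕ}
    (hf : f ∈ Polynomial.degreeLT ℝ n) :
    (FewDistance.expansion Φ f).support ⊆ Finset.range n := by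
  have hu : ∀ i, IsUnit (Φ i).leadingCoeff := fun i =>
    (Polynomial.leadingCoeff_ne_zero.mpr (Φ.ne_zero i)).isUnit
  rw [← Φ.span_degreeLT fun i _ => hu i] at hf
  have : (Φ : ℕ → Polynomial ℝ) = Φ.basis hu := by ext1 i; simp
  rw [this, Module.Basis.mem_span_image] at hf
  intro i hi
  simpa using hf hi

end Polynomial.Sequence

namespace FewDistance

section Codes

variable {M : Type*} [MetricSpace M] {τ : ℝ → ℝ}

theorem mem_distances {X : Finset M} {d : ℝ} :
    d ∈ distances τ X ↔ ∃ x ∈ X, ∃ y ∈ X, x ≠ y ∧ τ (dist x y) = d := by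
  classical
  simp [distances, Prod.exists, and_assoc]

theorem ne_of_mem_distances (hτ : Set.InjOn τ (Set.range fun p : M × M => dist p.1 p.2))
    {X : Finset M} {d : ℝ} (hd : d ∈ distances τ X) : d ≠ τ 0 := by
  obtain ⟨x, -, y, -, hxy, rfl⟩ := mem_distances.1 hd
  intro h
  exact hxy (dist_eq_zero.1 (hτ ⟨(x, y), rfl⟩ ⟨(x, x), dist_self x⟩ h))

end Codes

theorem annihilator_mem_degreeLT (τ₀ : ℝ) (D : Finset ℝ) :
    annihilator τ₀ D ∈ Polynomial.degreeLT ℝ (D.card + 1) := by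
  rw [Polynomial.mem_degreeLT]
  refine lt_of_le_of_lt (Polynomial.degree_prod_le _ _) ?_
  refine lt_of_le_of_lt (Finset.sum_le_card_nsmul _ _ 1 fun d _ => ?_) ?_
  · compute_degree
  · rw [nsmul_one]
    exact_mod_cast Nat.lt_succ_self _

theorem annihilator_eval_self {τ₀ : ℝ} {D : Finset ℝ} (h : τ₀ ∉ D) :
    (annihilator τ₀ D).eval τ₀ = 1 := by
  rw [annihilator, Polynomial.eval_prod]
  refine Finset.prod_eq_one fun d hd => ?_
  have : d - τ₀ ≠ 0 := sub_ne_zero.2 fun e => h (e ▸ hd)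
  simp [this]

theorem annihilator_eval_of_mem {τ₀ d : ℝ} {D : Finset ℝ} (h : d ∈ D) :
    (annihilator τ₀ D).eval d = 0 := by
  rw [annihilator, Polynomial.eval_prod]
  exact Finset.prod_eq_zero h (by simp)

variable {G M : Type*} [Group G] [MetricSpace M] [MulAction G M] [TopologicalSpace G]
  [ContinuousSMul G M] [MeasurableSpace M] {μ : Measure M} {𝓗 : SphericalHarmonics G μ}
  {τ : ℝ → ℝ} {Φ : Polynomial.Sequence ℝ}

/-! ### The two bounds and the integrality of the ratios. -/

/-- Delsarte's linear programming bound. -/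
theorem card_le_lpBound [CompactSpace M] [Nonempty M] [BorelSpace M] [IsProbabilityMeasure μ]
    (hΦ : 𝓗.IsZonalFamily τ Φ) (X : Finset M) :
    ((X.card : ℝ) : EReal) ≤ lpBound 𝓗 Φ (distances τ X) := by
  classical
  rcases X.eq_empty_or_nonempty with rfl | hX
  · refine le_trans ?_ (le_sSup ⟨0, ?_, ?_, rfl⟩)
    · simp
    · simp
    · simp
  have hn : (0 : ℝ) < X.card := by exact_mod_cast hX.card_pos
  -- The inner distribution of X: the average number of points of X at τ-value d from a point of X.
  let α : ℝ → ℝ := fun d =>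
    (X.offDiag.filter fun p => τ (dist p.1 p.2) = d).card / X.card
  have hsum : ∀ g : ℝ → ℝ, ∑ d ∈ distances τ X, α d * g d
      = (∑ p ∈ X.offDiag, g (τ (dist p.1 p.2))) / X.card := by
    intro g
    rw [Finset.sum_comp g fun p : M × M => τ (dist p.1 p.2), Finset.sum_div]
    refine Finset.sum_congr (by simp [distances]) fun d _ => ?_
    simp only [α, nsmul_eq_mul]
    ring
  refine le_sSup ⟨α, fun d _ => by positivity, fun k hk => ?_, ?_⟩
  · rw [hsum, le_div_iff₀ hn]
    -- The diagonal contributes |X| to this nonnegative sum, which is the source of the -1 in the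
    -- constraint.
    have h := hΦ.sum_eval_nonneg hk X
    rw [← Finset.sum_product', ← Finset.diag_union_offDiag,
      Finset.sum_union (Finset.disjoint_diag_offDiag X), Finset.sum_diag] at h
    simp only [dist_self, hΦ.eval_zero hk, Finset.sum_const, nsmul_eq_mul, mul_one] at h
    linarith
  · have h := hsum fun _ => 1
    simp only [mul_one, Finset.sum_const, nsmul_eq_mul, Finset.offDiag_card] at h
    rw [h]
    congr 1
    have : X.card ≤ X.card * X.card := Nat.le_mul_self _
    push_cast [Nat.cast_sub this]
    field_simp
    ring

theorem eval_eq_sum_expansion (f : Polynomial ℝ) (t : ℝ) :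
    f.eval t = ∑ k ∈ (expansion Φ f).support, expansion Φ f k * (Φ k).eval t := by
  conv_lhs => rw [← Φ.sum_basis_repr_smul f]
  simp [Polynomial.eval_finsetSum]

/-- The harmonic absolute bound. -/
theorem card_le_harmonicBound (hτ : Set.InjOn τ (Set.range fun p : M × M => dist p.1 p.2))
    (hΦ : 𝓗.IsZonalFamily τ Φ) (X : Finset M)
    (hV : ∀ k ≤ (distances τ X).card, 𝓗.V k ≠ ⊥) :
    X.card ≤ harmonicBound 𝓗 τ Φ (distances τ X) := by
  classical
  set f := annihilator (τ 0) (distances τ X) with hf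
  set S := (expansion Φ f).support.filter fun i => 0 < expansion Φ f i with hS
  have hsupp := Φ.expansion_support_subset (annihilator_mem_degreeLT (τ 0) (distances τ X))
  have hτ0 : τ 0 ∉ distances τ X := fun h => ne_of_mem_distances hτ h rfl
  have hdim := 𝓗.card_le_add_finrank_ker_moments X S
  suffices Module.finrank ℂ (LinearMap.ker (𝓗.moments X S)) = 0 by
    rw [this] at hdim
    exact hdim
  rw [Submodule.finrank_eq_zero, Submodule.eq_bot_iff]
  intro c hc
  -- The matrix of f on X is the identity, so its quadratic form at c is ‖c‖².
  have hker : ∀ x y : X, (((f.eval (τ (dist (x : M) y)) : ℝ)) : ℂ) = if x = y then 1 else 0 := by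
    intro x y
    split_ifs with h
    · rw [h, dist_self, hf, annihilator_eval_self hτ0, Complex.ofReal_one]
    · rw [hf, annihilator_eval_of_mem, Complex.ofReal_zero]
      exact mem_distances.2 ⟨x, x.2, y, y.2, fun e => h (Subtype.ext e), rfl⟩
  have h1 : ∑ x : X, conj (c x) * ∑ y : X, ((f.eval (τ (dist (x : M) y)) : ℝ) : ℂ) * c y
      = ((∑ x : X, ‖c x‖ ^ 2 : ℝ) : ℂ) := by
    simp [hker, Complex.conj_mul']
  have h2 : ∑ x : X, conj (c x) * ∑ y : X, ((f.eval (τ (dist (x : M) y)) : ℝ) : ℂ) * c y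
      = ((∑ k ∈ (expansion Φ f).support, expansion Φ f k *
          ((1 / (𝓗.h k : ℝ)) * ∑ i, ‖𝓗.moment X k i c‖ ^ 2) : ℝ) : ℂ) := by
    rw [Complex.ofReal_sum]
    have : ∀ k ∈ (expansion Φ f).support, ((expansion Φ f k *
        ((1 / (𝓗.h k : ℝ)) * ∑ i, ‖𝓗.moment X k i c‖ ^ 2) : ℝ) : ℂ)
        = ∑ x : X, ∑ y : X, expansion Φ f k * (conj (c x) *
          ((((Φ k).eval (τ (dist (x : M) y)) : ℝ) : ℂ) * c y)) := by
      intro k hk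
      rw [Complex.ofReal_mul, ← hΦ.sum_conj_mul_eval_mul
        (hV k (Nat.lt_succ_iff.1 (Finset.mem_range.1 (hsupp hk)))) X c]
      simp only [Finset.mul_sum]
    rw [Finset.sum_congr rfl this, Finset.sum_comm]
    refine Finset.sum_congr rfl fun x _ => ?_
    rw [Finset.sum_comm, Finset.mul_sum]
    refine Finset.sum_congr rfl fun y _ => ?_
    rw [eval_eq_sum_expansion (Φ := Φ) f]
    push_cast
    rw [Finset.sum_mul, Finset.mul_sum]
    refine Finset.sum_congr rfl fun k _ => ?_
    ring
  have h3 : ∑ x : X, ‖c x‖ ^ 2 ≤ 0 := by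
    rw [Complex.ofReal_injective (h1.symm.trans h2)]
    -- Terms with f_k > 0 vanish by the choice of c, and the remaining ones are nonpositive.
    refine Finset.sum_nonpos fun k hk => ?_
    by_cases hpos : 0 < expansion Φ f k
    · have hkS : k ∈ S := Finset.mem_filter.2 ⟨hk, hpos⟩
      simp [𝓗.moment_eq_zero hc hkS]
    · exact mul_nonpos_of_nonpos_of_nonneg (not_lt.1 hpos) (by positivity)
  ext x
  have h4 : ‖c x‖ ^ 2 ≤ 0 :=
    (Finset.single_le_sum (f := fun x => ‖c x‖ ^ 2) (fun x _ => by positivity)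
      (Finset.mem_univ x)).trans h3
  simpa using le_antisymm h4 (by positivity)

theorem harmonicBound_le_N (D : Finset ℝ) : harmonicBound 𝓗 τ Φ D ≤ 𝓗.N (D.card + 1) :=
  Finset.sum_le_sum_of_subset ((Finset.filter_subset _ _).trans
    (Φ.expansion_support_subset (annihilator_mem_degreeLT (τ 0) D)))

/-- Normalizing at d instead of τ₀ turns `annihilator` into the Lagrange polynomial of d on D, and
K_d is its value at τ₀. -/
theorem annihilator_eval_eq_ratio (τ₀ : ℝ) (D : Finset ℝ) (d : ℝ) :
    (annihilator d (D.erase d)).eval τ₀ = ratio τ₀ D d := by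
  rw [annihilator, Polynomial.eval_prod, ratio]
  refine Finset.prod_congr rfl fun e _ => ?_
  simp [div_eq_inv_mul]

/-- The integrality of the ratios of a large `s`-distance set. -/
theorem exists_int_ratio_eq (hΦ : 𝓗.IsZonalFamily τ Φ) (X : Finset M)
    (hV : ∀ k < (distances τ X).card, 𝓗.V k ≠ ⊥)
    (hX : 2 * 𝓗.N (distances τ X).card ≤ X.card) {d : ℝ} (hd : d ∈ distances τ X)
    (hd0 : d ≠ τ 0) :
    ∃ z : ℤ, ratio (τ 0) (distances τ X) d = z := by
  classical
  set D := distances τ X with hD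
  set f := annihilator d (D.erase d) with hf
  have hcard : (D.erase d).card + 1 = D.card := Finset.card_erase_add_one hd
  have hsupp : (expansion Φ f).support ⊆ Finset.range D.card :=
    hcard ▸ Φ.expansion_support_subset (annihilator_mem_degreeLT d (D.erase d))
  obtain ⟨x₀, hx₀, -⟩ := mem_distances.1 hd
  have : Nonempty X := ⟨⟨x₀, hx₀⟩⟩
  let A : Matrix X X ℤ := fun x y => if τ (dist (x : M) y) = d then 1 else 0
  have hker : ∀ x y : X, f.eval (τ (dist (x : M) y))
      = (if x = y then ratio (τ 0) D d else 0) + A x y := by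
    intro x y
    by_cases h : x = y
    · simp [h, A, hf, annihilator_eval_eq_ratio, hd0.symm]
    · by_cases h' : τ (dist (x : M) y) = d
      · simp only [h, A, h', if_true, if_false, hf]
        rw [annihilator_eval_self (Finset.notMem_erase d D)]
        simp
      · simp only [h, A, h', if_false, hf]
        rw [annihilator_eval_of_mem]
        · simp
        · exact Finset.mem_erase.2 ⟨h', mem_distances.2
            ⟨x, x.2, y, y.2, fun e => h (Subtype.ext e), rfl⟩⟩
  -- Since deg f < s, vectors whose moments of degree below s vanish are killed by K_d I + A.
  have hle : LinearMap.ker (𝓗.moments X (Finset.range D.card)) ≤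
      Module.End.eigenspace (Matrix.toLin' (A.map (Int.cast : ℤ → ℂ)))
        (-(ratio (τ 0) D d : ℂ)) := by
    intro c hc
    rw [Module.End.mem_eigenspace_iff]
    ext x
    have h0 : ∑ y : X, ((f.eval (τ (dist (x : M) y)) : ℝ) : ℂ) * c y = 0 := by
      simp only [eval_eq_sum_expansion (Φ := Φ) f]
      push_cast
      simp only [Finset.sum_mul, mul_assoc]
      rw [Finset.sum_comm]
      refine Finset.sum_eq_zero fun k hk => ?_
      have hk' := hsupp hk
      rw [← Finset.mul_sum]
      simp only [← hΦ k (hV k (Finset.mem_range.1 hk')), 𝓗.sum_zonal_mul X k c,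
        𝓗.moment_eq_zero hc hk', mul_zero, Finset.sum_const_zero]
    simp only [hker] at h0
    push_cast at h0
    simp only [add_mul, Finset.sum_add_distrib, ite_mul, zero_mul, Finset.sum_ite_eq,
      Finset.mem_univ, if_true, apply_ite (Complex.ofReal), Complex.ofReal_zero] at h0
    simp only [Matrix.toLin'_apply, Matrix.mulVec, dotProduct, Matrix.map_apply, Pi.smul_apply,
      smul_eq_mul]
    linear_combination h0
  obtain ⟨z, hz⟩ := Matrix.exists_int_eq_of_card_le_two_mul_finrank_eigenspace A
    (Matrix.IsSymm.ext fun x y => by simp [A, dist_comm])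
    (fun x => by simp [A, hd0.symm])
    (fun x y => by by_cases h : τ (dist (x : M) y) = d <;> simp [A, h])
    (-(ratio (τ 0) D d : ℂ)) (by
      have h1 := 𝓗.card_le_add_finrank_ker_moments X (Finset.range D.card)
      have h2 := Submodule.finrank_mono hle
      have h3 : ∑ k ∈ Finset.range D.card, 𝓗.h k = 𝓗.N D.card := rfl
      rw [Fintype.card_coe]
      omega)
  refine ⟨-z, ?_⟩
  have : (ratio (τ 0) D d : ℂ) = ((-z : ℤ) : ℝ) := by
    push_cast
    linear_combination -hz
  exact_mod_cast this

end FewDistance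

/-! ### Dichotomy for s-distance sets and the main theorem. -/

namespace FewDistance

variable {G M : Type*} [Group G] [MetricSpace M] [MulAction G M] [TopologicalSpace G]
  [ContinuousSMul G M] [MeasurableSpace M] {μ : Measure M} {𝓗 : SphericalHarmonics G μ}
  {τ : ℝ → ℝ} {Φ : Polynomial.Sequence ℝ}

section

variable [CompactSpace M] [BorelSpace M] [IsProbabilityMeasure μ] [μ.IsOpenPosMeasure]

theorem card_le_N_succ (hτ : Set.InjOn τ (Set.range fun p : M × M => dist p.1 p.2))
    (hΦ : 𝓗.IsZonalFamily τ Φ) {s : ℕ} {X : Finset M} (hX : IsDistanceSet τ s X) :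
    X.card ≤ 𝓗.N (s + 1) := by
  by_cases h : 𝓗.V s = ⊥
  · exact (𝓗.card_le_N_of_V_eq_bot h X).trans
      (Finset.sum_le_sum_of_subset (Finset.range_subset_range.2 s.le_succ))
  · have hcard : (distances τ X).card = s := hX
    rw [← hcard]
    exact (card_le_harmonicBound hτ hΦ X fun k hk hbot =>
      h (𝓗.V_eq_bot_of_le hbot (hcard ▸ hk))).trans (harmonicBound_le_N _)

variable [Nonempty M]

/-- Otherwise M would have at most N(M,0) = 0 points. -/
theorem SphericalHarmonics.V_zero_ne_bot (𝓗 : SphericalHarmonics G μ) : 𝓗.V 0 ≠ ⊥ := by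
  intro h
  obtain ⟨x⟩ := ‹Nonempty M›
  simpa [SphericalHarmonics.N] using 𝓗.card_le_N_of_V_eq_bot h {x}

theorem SphericalHarmonics.N_pos (𝓗 : SphericalHarmonics G μ) {s : ℕ} (hs : 0 < s) :
    0 < 𝓗.N s :=
  (𝓗.h_pos 𝓗.V_zero_ne_bot).trans_le
    (Finset.single_le_sum (fun _ _ => Nat.zero_le _) (Finset.mem_range.2 hs))

/-- An `s`-distance set is either small or subject to the bound `B(D(X))`. -/
theorem card_le_or_exists_bound
    (hτ : Set.InjOn τ (Set.range fun p : M × M => dist p.1 p.2))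
    (hΦ : 𝓗.IsZonalFamily τ Φ) {s : ℕ} {X : Finset M} (hX : IsDistanceSet τ s X) :
    X.card + 1 ≤ 2 * 𝓗.N s ∨
      ∃ D ∈ admissible M τ s, ((X.card : ℝ) : EReal) ≤ bound 𝓗 τ Φ D := by
  have hcard : (distances τ X).card = s := hX
  by_cases h : 𝓗.V s = ⊥
  · left
    -- Positivity of s gives N(M,s) ≥ 1, so |X| ≤ N(M,s) implies |X| ≤ 2N(M,s) - 1.
    have hs : 0 < s := Nat.pos_of_ne_zero fun h0 => 𝓗.V_zero_ne_bot (h0 ▸ h)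
    have h1 := 𝓗.N_pos hs
    have h2 := 𝓗.card_le_N_of_V_eq_bot h X
    omega
  · have hV : ∀ k ≤ (distances τ X).card, 𝓗.V k ≠ ⊥ := fun k hk hbot =>
      h (𝓗.V_eq_bot_of_le hbot (hcard ▸ hk))
    rcases lt_or_ge X.card (2 * 𝓗.N s) with hlt | hge
    · exact .inl hlt
    · refine .inr ⟨distances τ X, ⟨⟨X, hX, rfl⟩, fun d hd => ?_⟩, le_min ?_ ?_⟩
      · exact exists_int_ratio_eq hΦ X (fun k hk => hV k hk.le) (by rwa [hcard]) hd
          (ne_of_mem_distances hτ hd)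
      · exact_mod_cast card_le_harmonicBound hτ hΦ X hV
      · exact card_le_lpBound hΦ X

end

end FewDistance

theorem theorem2p6 {G M : Type*} [Group G] [TopologicalSpace G] [IsTopologicalGroup G]
    [CompactSpace G] [MetricSpace M] [Nonempty M] [MulAction G M] [ContinuousSMul G M]
    [MeasurableSpace M] [BorelSpace M]
    (hM : FewDistance.IsTwoPointHomogeneous G M)
    (μ : Measure M) [IsProbabilityMeasure μ] [SMulInvariantMeasure G M μ]
    (τ : ℝ → ℝ) (hτ : Set.InjOn τ (Set.range fun p : M × M => dist p.1 p.2))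
    (𝓗 : FewDistance.SphericalHarmonics G μ) (Φ : Polynomial.Sequence ℝ)
    (hΦ : 𝓗.IsZonalFamily τ Φ) (s : ℕ) :
    BddAbove (FewDistance.codeSizes M τ s) ∧
    (((FewDistance.maxCode M τ s : ℕ) : ℝ) : EReal) ≤
      max (⨆ D ∈ FewDistance.admissible M τ s, FewDistance.bound 𝓗 τ Φ D)
        ((2 * (𝓗.N s : ℝ) - 1 : ℝ) : EReal) ∧
    ((((FewDistance.maxCode M τ s : ℕ) : ℝ) : EReal) ≤ ((2 * (𝓗.N s : ℝ) - 1 : ℝ) : EReal) ∨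
      ∃ D ∈ FewDistance.admissible M τ s,
        (((FewDistance.maxCode M τ s : ℕ) : ℝ) : EReal) ≤ FewDistance.bound 𝓗 τ Φ D) := by
  have := hM.compactSpace
  have := hM.isOpenPosMeasure μ
  have hbdd : BddAbove (FewDistance.codeSizes M τ s) := by
    refine ⟨𝓗.N (s + 1), ?_⟩
    rintro _ ⟨X, hX, rfl⟩
    exact FewDistance.card_le_N_succ hτ hΦ hX
  have key : (((FewDistance.maxCode M τ s : ℕ) : ℝ) : EReal) ≤ ((2 * (𝓗.N s : ℝ) - 1 : ℝ) : EReal) ∨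
      ∃ D ∈ FewDistance.admissible M τ s,
        (((FewDistance.maxCode M τ s : ℕ) : ℝ) : EReal) ≤ FewDistance.bound 𝓗 τ Φ D := by
    have hcast : ∀ n : ℕ, n + 1 ≤ 2 * 𝓗.N s →
        ((n : ℝ) : EReal) ≤ ((2 * (𝓗.N s : ℝ) - 1 : ℝ) : EReal) := by
      intro n hn
      have : (n : ℝ) + 1 ≤ 2 * 𝓗.N s := by exact_mod_cast hn
      exact EReal.coe_le_coe_iff.2 (by linarith)
    rcases (FewDistance.codeSizes M τ s).eq_empty_or_nonempty with he | hne
    -- The empty set is a 0-distance set, so s > 0 here; the supremum of the empty set of sizes is 0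
    -- ≤ 2N(M,s) - 1.
    · have hs : 0 < s := by
        refine Nat.pos_of_ne_zero fun h0 => ?_
        have : (0 : ℕ) ∈ FewDistance.codeSizes M τ s :=
          ⟨∅, by simp [FewDistance.IsDistanceSet, FewDistance.distances, h0], rfl⟩
        simp [he] at this
      have h1 := 𝓗.N_pos hs
      left
      apply hcast
      rw [FewDistance.maxCode, he, csSup_empty, bot_eq_zero]
      omega
    -- The maximum is attained, so the dichotomy for a single X yields one D that bounds A(M,s).
    · obtain ⟨X, hX, hXc⟩ := Nat.sSup_mem hne hbdd
      rw [FewDistance.maxCode, ← hXc]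
      exact (FewDistance.card_le_or_exists_bound hτ hΦ hX).imp_left (hcast _)
  refine ⟨hbdd, ?_, key⟩
  rcases key with h | ⟨D, hD, h⟩
  · exact le_max_of_le_right h
  · exact le_max_of_le_left (h.trans (le_iSup₂_of_le D hD le_rfl))
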